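/- Let $K$ be a field, $S=K[x_1,\dots,x_n]$ with its standard $\mathbb Z^n$-grading, and for a monomial ideal $I\subset S$ call a complex $\mathbb F:\ \cdots\to F_2\xrightarrow{\phi_2}F_1\xrightarrow{\phi_1}F_0\to 0$ a *multigraded free resolution* of $S/I$ if every $F_i$ is a free module $\bigoplus_{g\in B_i}Sg\cong\bigoplus_{g\in B_i}S(-\deg g)$ with a homogeneous basis $B_i$ with multidegrees $\deg g\in\mathbb Z^n$, every $\phi_i$ is a homomorphism of multigraded modules (of degree $0$), $H_i(\mathbb F)=0$ for $i>0$, and $H_0(\mathbb F)\cong S/I$ as multigraded modules. (Minimality is not required, and the ranks and the length may be infinite.) For a homogeneous element $g$ write $u_g=x^{\deg g}$, and for (Laurent) monomials write $[x^a,x^b]=x^{\max(a,b)}$ (componentwise maximum), the least common multiple. Let $I$ and $J$ be monomial ideals in $S$, let $(\mathbb F,\phi)$ be a multigraded free resolution of $S/I$ with homogeneous bases $B_i$, and let $(\mathbb G,\psi)$ be a multigraded free resolution of $S/J$ with homogeneous bases $B'_i$. Write $$\phi_i(g)=\sum_{h\in B_{i-1}}a_{gh}\frac{u_g}{u_h}h\quad(g\in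 B_i),\qquad \psi_i(e)=\sum_{f\in B'_{i-1}}b_{ef}\frac{u_e}{u_f}f\quad(e\in B'_i),$$ with $a_{gh},b_{ef}\in K$, where $a_{gh}=0$ unless $\deg h\le\deg g$ componentwise, and $b_{ef}=0$ unless $\deg f\le\deg e$ componentwise. Let $\mathbb F*\mathbb G$ be the sequence of free $S$-modules and maps in which $(\mathbb F*\mathbb G)_i$ has as basis the symbols $g*e$ with $g\in B_j$, $e\in B'_k$, $j+k=i$, where $g*e$ has the multidegree of $[u_g,u_e]$, and in which the map $\alpha_i:(\mathbb F*\mathbb G)_i\to(\mathbb F*\mathbb G)_{i-1}$ is given, for $g\in B_j$, $e\in B'_k$, $j+k=i$, by $$\alpha_i(g*e)=\sum_{h\in B_{j-1}}a_{gh}\frac{[u_g,u_e]}{[u_h,u_e]}\,h*e+(-1)^j\sum_{f\in B'_{k-1}}b_{ef}\frac{[u_g,u_e]}{[u_g,u_f]}\,g*f$$ (the first sum is $0$ if $j=0$, the second is $0$ if $k=0$). Then $\mathbb F*\mathbb G$ is a multigraded free resolution of $S/(I+J)$. Moreover, if $\mathbb F$ and $\mathbb G$ have finite length and consist of modules of finite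 rank, then so does $\mathbb F*\mathbb G$. -/

import Mathlib

namespace LcmTensor

/-- The exponent vector of the monomial `x ^ (a - b)`, for `a b : ℤⁿ` with `b ≤ a` componentwise.
It is used only for such pairs (the coefficient in front of the monomial is zero otherwise). -/
noncomputable def expSub {n : ℕ} (a b : Fin n → ℤ) : Fin n →₀ ℕ :=
  Finsupp.equivFunOnFinite.symm fun i => (a i - b i).toNat

/-- An ideal of `K[x_1, …, x_n]` generated by monomials. -/
def IsMonomialIdeal {K : Type*} [Field K] {n : ℕ} (I : Ideal (MvPolynomial (Fin n) K)) : Prop :=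
  ∃ A : Set (Fin n →₀ ℕ), I = Ideal.span ((fun m => MvPolynomial.monomial m (1 : K)) '' A)

/-- The free module `⨁_{b ∈ B} S(-deg b)` with homogeneous basis `B`, where `b` has multidegree
`deg b ∈ ℤⁿ`: this is its component of multidegree `a`.  An element `∑ p_b b` lies in it iff every
monomial `x ^ m` occurring in a coefficient `p_b` satisfies `m + deg b = a`. -/
def IsHomogeneousOfDegree {K : Type*} [Field K] {n : ℕ} {B : Type*} (deg : B → Fin n → ℤ)
    (a : Fin n → ℤ) (x : B →₀ MvPolynomial (Fin n) K) : Prop :=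
  ∀ b, ∀ m ∈ (x b).support, (fun i => (m i : ℤ)) + deg b = a

/-- The component of multidegree `a ∈ ℤⁿ` of `S / I` : the classes of polynomials all of whose
monomials have exponent vector `a` (so it is zero unless `0 ≤ a`). -/
def IsHomogeneousQuotElem {K : Type*} [Field K] {n : ℕ} (I : Ideal (MvPolynomial (Fin n) K))
    (a : Fin n → ℤ) (y : MvPolynomial (Fin n) K ⧸ I) : Prop :=
  ∃ p : MvPolynomial (Fin n) K, (∀ m ∈ p.support, (fun i => (m i : ℤ)) = a) ∧
    Ideal.Quotient.mk I p = y

/-- A sequence `⋯ ⟶ F_2 ⟶ F_1 ⟶ F_0` of `S`-linear maps between the free modules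
`F_i = ⨁_{b ∈ B_i} S(-deg b)` with prescribed bases `B_i` of prescribed multidegrees;
`d i : F_{i+1} ⟶ F_i`.  That the maps are multigraded and that the sequence is a complex (and
exact) is part of `IsMultigradedFreeResolution` below. -/
structure FreeSequence (K : Type*) [Field K] (n : ℕ) where
  /-- the basis of the module in homological degree `i` -/
  B : ℕ → Type*
  /-- the multidegrees of the basis elements -/
  deg : ∀ i, B i → Fin n → ℤ
  /-- the differential -/
  d : ∀ i, (B (i + 1) →₀ MvPolynomial (Fin n) K) →ₗ[MvPolynomial (Fin n) K]
    (B i →₀ MvPolynomial (Fin n) K)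

namespace FreeSequence

variable {K : Type*} [Field K] {n : ℕ}

/-- `F` is a multigraded free `S`-resolution of `S / I`. -/
structure IsMultigradedFreeResolution (F : FreeSequence K n)
    (I : Ideal (MvPolynomial (Fin n) K)) : Prop where
  /-- the differentials are homomorphisms of multigraded modules -/
  homogeneous : ∀ i a x, IsHomogeneousOfDegree (F.deg (i + 1)) a x →
    IsHomogeneousOfDegree (F.deg i) a (F.d i x)
  /-- `F` is a complex -/
  d_comp_d : ∀ i, F.d i ∘ₗ F.d (i + 1) = 0
  /-- `H_i(F) = 0` for `i > 0` -/
  acyclic : ∀ i, Function.Exact (F.d (i + 1)) (F.d i)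
  /-- `H_0(F) = F_0 / im (F_1 ⟶ F_0)` is isomorphic to `S / I` as a multigraded module -/
  augmentation : ∃ ε : (F.B 0 →₀ MvPolynomial (Fin n) K) →ₗ[MvPolynomial (Fin n) K]
      (MvPolynomial (Fin n) K ⧸ I),
    Function.Surjective ε ∧ Function.Exact (F.d 0) ε ∧
    ∀ a x, IsHomogeneousOfDegree (F.deg 0) a x → IsHomogeneousQuotElem I a (ε x)

/-- `F` has finite length, and the modules in it have finite rank. -/
def IsFinite (F : FreeSequence K n) : Prop :=
  (∀ i, Finite (F.B i)) ∧ ∃ p, ∀ i, p < i → IsEmpty (F.B i)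

/-- The scalar `a_{gh} ∈ K` in `d g = ∑_h a_{gh} x ^ (deg g - deg h) h`. -/
noncomputable def scalar (F : FreeSequence K n) (i : ℕ) (g : F.B (i + 1)) (h : F.B i) : K :=
  MvPolynomial.coeff (expSub (F.deg (i + 1) g) (F.deg i h)) (F.d i (Finsupp.single g 1) h)

/-- The symbols `g * e` of homological degree `i`, where `g ∈ B_j`, `e ∈ B'_k` and `j + k = i`. -/
structure StarBasis (F G : FreeSequence K n) (i : ℕ) where
  /-- homological degree of the left factor -/
  j : ℕ
  /-- homological degree of the right factor -/
  k : ℕ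
  /-- the left factor -/
  left : F.B j
  /-- the right factor -/
  right : G.B k
  add_eq : j + k = i

/-- The multidegree of `g * e`: the exponent of the lcm of the monomials `x ^ deg g` and
`x ^ deg e`, that is, the componentwise maximum. -/
def StarBasis.deg {F G : FreeSequence K n} {i : ℕ} (b : StarBasis F G i) : Fin n → ℤ :=
  F.deg b.j b.left ⊔ G.deg b.k b.right

/-- `∑_{h ∈ B_{j-1}} a_{gh} ([u_g, u_e] / [u_h, u_e]) h * e` for `g ∈ B_j`, `e ∈ B'_k`
(zero if `j = 0`). -/
noncomputable def starLeft (F G : FreeSequence K n) (i : ℕ) :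
    (j k : ℕ) → (g : F.B j) → (e : G.B k) → j + k = i + 1 →
      (StarBasis F G i →₀ MvPolynomial (Fin n) K)
  | 0, _, _, _, _ => 0
  | j + 1, k, g, e, hjk => ∑ h ∈ (F.d j (Finsupp.single g 1)).support,
      Finsupp.single (⟨j, k, h, e, by omega⟩ : StarBasis F G i)
        (MvPolynomial.monomial
          (expSub (F.deg (j + 1) g ⊔ G.deg k e) (F.deg j h ⊔ G.deg k e)) (F.scalar j g h))

/-- `∑_{f ∈ B'_{k-1}} b_{ef} ([u_g, u_e] / [u_g, u_f]) g * f` for `g ∈ B_j`, `e ∈ B'_k`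
(zero if `k = 0`). -/
noncomputable def starRight (F G : FreeSequence K n) (i : ℕ) :
    (j k : ℕ) → (g : F.B j) → (e : G.B k) → j + k = i + 1 →
      (StarBasis F G i →₀ MvPolynomial (Fin n) K)
  | _, 0, _, _, _ => 0
  | j, k + 1, g, e, hjk => ∑ f ∈ (G.d k (Finsupp.single e 1)).support,
      Finsupp.single (⟨j, k, g, f, by omega⟩ : StarBasis F G i)
        (MvPolynomial.monomial
          (expSub (F.deg j g ⊔ G.deg (k + 1) e) (F.deg j g ⊔ G.deg k f)) (G.scalar k e f))

/-- The sequence `F * G`: its module in homological degree `i` has basis the symbols `g * e`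
with `g ∈ B_j`, `e ∈ B'_k`, `j + k = i`, and its differential sends `g * e` to
`∑_h a_{gh} ([u_g, u_e] / [u_h, u_e]) h * e + (-1) ^ j ∑_f b_{ef} ([u_g, u_e] / [u_g, u_f]) g * f`. -/
noncomputable def star (F G : FreeSequence K n) : FreeSequence K n where
  B := StarBasis F G
  deg _ b := b.deg
  d i := Finsupp.linearCombination (MvPolynomial (Fin n) K) fun b : StarBasis F G (i + 1) =>
    starLeft F G i b.j b.k b.left b.right b.add_eq +
      (-1 : MvPolynomial (Fin n) K) ^ b.j • starRight F G i b.j b.k b.left b.right b.add_eq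

end FreeSequence

end LcmTensor

namespace LcmTensor

/-! ### Multigraded strands as subspaces of one vector space -/

section Strands

variable {K : Type*} [Field K] {n : ℕ} {B B' : Type*}

/-! Everything is checked one multidegree at a time, over `K`. A basis element `b` contributes to
the component of multidegree `a` exactly when `deg b ≤ a`, and then through the single monomial `x ^
(a - deg b)`. So the strand of `F` in multidegree `a` is the span of the `b` with `deg b ≤ a`, and
the differential on every strand is the restriction of one scalar matrix
(`IsHomogenization.component_map`).

The key point is that `[u_g, u_e]` divides `x ^ a` iff both `u_g` and `u_e` do. Hence the strand of
`F * G` in multidegree `a` is the ordinary tensor product over `K` of the strands of `F` and `G`,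
with the usual signs. By Künneth its homology sits in degree zero and is `(S/I)_a ⊗ (S/J)_a`. Each
factor is `0` or `K`, and the product vanishes exactly when one factor does, that is, when
`(S/(I+J))_a` vanishes.

Künneth is made explicit. Over a field each strand contracts onto its homology
(`nonempty_contraction`), and contractions `h`, `h'` of the factors give the contraction `h ⊗ 1 + π
⊗ h'` of the product, `π` being the projection onto homology (`starScalarMap_starHomotopy_succ`,
`starScalarMap_starHomotopy_zero`). `StrandResolution` is the dictionary between resolutions and
strands: `exists_strandResolution` enters it, `StrandResolution.isMultigradedFreeResolution` leaves
it. -/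

lemma expSub_eq_iff {a b : Fin n → ℤ} (h : b ≤ a) (m : Fin n →₀ ℕ) :
    expSub a b = m ↔ (fun i => (m i : ℤ)) + b = a := by
  constructor
  · rintro rfl
    funext i
    have : b i ≤ a i := h i
    simp only [expSub, Finsupp.equivFunOnFinite_symm_apply_apply, Pi.add_apply]
    omega
  · rintro rfl
    ext i
    simp [expSub]

lemma expSub_add_self (m : Fin n →₀ ℕ) (b : Fin n → ℤ) :
    expSub ((fun i => (m i : ℤ)) + b) b = m := by
  ext i
  simp [expSub]

lemma le_natCast_add (m : Fin n →₀ ℕ) (b : Fin n → ℤ) : b ≤ (fun i => (m i : ℤ)) + b := by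
  intro i
  simp

/-- The `K`-span of the basis elements of multidegree at most `a`, identified with the component
of multidegree `a` of the free module. -/
def strand (K : Type*) [Field K] (deg : B → Fin n → ℤ) (a : Fin n → ℤ) : Submodule K (B →₀ K) :=
  Finsupp.supported K K {b | deg b ≤ a}

lemma mem_strand {deg : B → Fin n → ℤ} {a : Fin n → ℤ} {y : B →₀ K} :
    y ∈ strand K deg a ↔ ∀ b, y b ≠ 0 → deg b ≤ a := by
  simp [strand, Finsupp.mem_supported, Set.subset_def]

lemma single_mem_strand {deg : B → Fin n → ℤ} {a : Fin n → ℤ} {b : B} (h : deg b ≤ a) (c : K) :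
    Finsupp.single b c ∈ strand K deg a :=
  Finsupp.single_mem_supported K c h

lemma strand_mono {deg : B → Fin n → ℤ} {a c : Fin n → ℤ} (h : a ≤ c) :
    strand K deg a ≤ strand K deg c :=
  Finsupp.supported_mono fun _ hb => le_trans hb h

lemma strand_induction {deg : B → Fin n → ℤ} {a : Fin n → ℤ} {N : Submodule K (B →₀ K)}
    (h : ∀ b, deg b ≤ a → Finsupp.single b 1 ∈ N) : strand K deg a ≤ N := by
  rw [strand, Finsupp.supported_eq_span_single, Submodule.span_le]
  rintro _ ⟨b, hb, rfl⟩
  exact h b hb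

/-- The map `∑ y_b b ↦ ∑ y_b x ^ (a - deg b) b`. -/
noncomputable def homogenize (deg : B → Fin n → ℤ) (a : Fin n → ℤ) :
    (B →₀ K) →ₗ[K] (B →₀ MvPolynomial (Fin n) K) :=
  Finsupp.linearCombination K fun b =>
    Finsupp.single b (MvPolynomial.monomial (expSub a (deg b)) (1 : K))

lemma homogenize_single (deg : B → Fin n → ℤ) (a : Fin n → ℤ) (b : B) (c : K) :
    homogenize deg a (Finsupp.single b c) =
      Finsupp.single b (MvPolynomial.monomial (expSub a (deg b)) c) := by
  simp [homogenize, Finsupp.smul_single, MvPolynomial.smul_monomial]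

open Classical in
/-- The coefficients of the component of multidegree `a` of an element of a free module. -/
noncomputable def component (deg : B → Fin n → ℤ) (a : Fin n → ℤ) :
    (B →₀ MvPolynomial (Fin n) K) →ₗ[K] (B →₀ K) where
  toFun x := Finsupp.onFinset x.support
    (fun b => if deg b ≤ a then (x b).coeff (expSub a (deg b)) else 0) (by
      intro b hb
      rw [Finsupp.mem_support_iff]
      rintro h
      simp [h] at hb)
  map_add' x y := by
    ext b
    by_cases h : deg b ≤ a <;> simp [h]
  map_smul' c x := by
    ext b
    by_cases h : deg b ≤ a <;> simp [h]

open Classical in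
lemma component_apply (deg : B → Fin n → ℤ) (a : Fin n → ℤ)
    (x : B →₀ MvPolynomial (Fin n) K) (b : B) :
    component deg a x b = if deg b ≤ a then (x b).coeff (expSub a (deg b)) else 0 := rfl

lemma component_natCast_add (deg : B → Fin n → ℤ) (m : Fin n →₀ ℕ)
    (x : B →₀ MvPolynomial (Fin n) K) (b : B) :
    component deg ((fun i => (m i : ℤ)) + deg b) x b = (x b).coeff m := by
  rw [component_apply, if_pos (le_natCast_add m _), expSub_add_self]

lemma component_mem_strand (deg : B → Fin n → ℤ) (a : Fin n → ℤ)
    (x : B →₀ MvPolynomial (Fin n) K) : component deg a x ∈ strand K deg a := by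
  rw [mem_strand]
  intro b hb
  by_contra h
  simp [component_apply, h] at hb

open Classical in
lemma component_single_monomial (deg : B → Fin n → ℤ) (a : Fin n → ℤ) (b : B)
    (m : Fin n →₀ ℕ) (c : K) :
    component deg a (Finsupp.single b (MvPolynomial.monomial m c)) =
      if (fun i => (m i : ℤ)) + deg b = a then Finsupp.single b c else 0 := by
  ext b'
  rw [component_apply]
  by_cases hb : b = b'
  · subst hb
    by_cases h : deg b ≤ a
    · have := expSub_eq_iff h m
      by_cases h' : (fun i => (m i : ℤ)) + deg b = a
      · simp [h, h', this.2 h']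
      · have h2 : m ≠ expSub a (deg b) := fun e => h' (this.1 e.symm)
        simp [h, h', h2, MvPolynomial.coeff_monomial]
    · have h' : (fun i => (m i : ℤ)) + deg b ≠ a := by
        rintro rfl
        exact h (le_natCast_add m _)
      simp [h, h']
  · by_cases h' : (fun i => (m i : ℤ)) + deg b = a <;> simp [h', hb]

-- `homogenize deg a y` is homogeneous of degree `a`, so it has no other component. Membership in
-- the strand guarantees that `expSub` truncates nothing.
open Classical in
lemma component_homogenize {deg : B → Fin n → ℤ} {a : Fin n → ℤ} (c : Fin n → ℤ) {y : B →₀ K}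
    (hy : y ∈ strand K deg a) :
    component deg c (homogenize deg a y) = if a = c then y else 0 := by
  let f : (B →₀ K) →ₗ[K] (B →₀ K) := if a = c then LinearMap.id else 0
  suffices h : strand K deg a ≤ LinearMap.eqLocus (component deg c ∘ₗ homogenize deg a) f by
    have := h hy
    rw [LinearMap.mem_eqLocus] at this
    rw [LinearMap.comp_apply] at this
    rw [this]
    simp only [f]
    split_ifs <;> rfl
  refine strand_induction fun b hb => ?_
  rw [LinearMap.mem_eqLocus, LinearMap.comp_apply, homogenize_single, component_single_monomial,
    (expSub_eq_iff hb _).1 rfl]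
  simp only [f]
  split_ifs <;> rfl

lemma eq_of_component_eq (deg : B → Fin n → ℤ) {x y : B →₀ MvPolynomial (Fin n) K}
    (h : ∀ a, component deg a x = component deg a y) : x = y := by
  ext b m
  rw [← component_natCast_add deg m x b, h, component_natCast_add]

lemma exists_finset_component_eq_zero (deg : B → Fin n → ℤ) (x : B →₀ MvPolynomial (Fin n) K) :
    ∃ Z : Finset (Fin n → ℤ), ∀ a, a ∉ Z → component deg a x = 0 := by
  classical
  refine ⟨x.support.biUnion fun b =>
    (x b).support.image fun m => (fun i => (m i : ℤ)) + deg b, fun a ha => ?_⟩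
  ext b
  rw [component_apply]
  split_ifs with h
  · by_contra h0
    refine ha (Finset.mem_biUnion.2 ⟨b, ?_, Finset.mem_image.2 ⟨expSub a (deg b), ?_, ?_⟩⟩)
    · rw [Finsupp.mem_support_iff]
      intro h1
      simp [h1] at h0
    · simpa using h0
    · exact (expSub_eq_iff h _).1 rfl
  · rfl

lemma isHomogeneousOfDegree_iff (deg : B → Fin n → ℤ) (a : Fin n → ℤ)
    (x : B →₀ MvPolynomial (Fin n) K) :
    IsHomogeneousOfDegree deg a x ↔ ∀ c, c ≠ a → component deg c x = 0 := by
  constructor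
  · intro h c hc
    ext b
    rw [component_apply]
    split_ifs with hb
    · by_contra h0
      exact hc (((expSub_eq_iff hb _).1 rfl).symm.trans
        (h b (expSub c (deg b)) (MvPolynomial.mem_support_iff.2 h0)))
    · rfl
  · intro h b m hm
    by_contra hne
    rw [MvPolynomial.mem_support_iff, ← component_natCast_add deg m x b, h _ hne] at hm
    exact hm rfl

lemma linearMap_ext_single_monomial {M : Type*} [AddCommMonoid M] [Module K M]
    {f g : (B →₀ MvPolynomial (Fin n) K) →ₗ[K] M}
    (h : ∀ b m c, f (Finsupp.single b (MvPolynomial.monomial m c)) =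
      g (Finsupp.single b (MvPolynomial.monomial m c))) : f = g := by
  refine Finsupp.lhom_ext' fun b => MvPolynomial.linearMap_ext fun m => LinearMap.ext fun c => ?_
  exact h b m c

/-- Multiplication by `x ^ m` from one strand to another is the inclusion of subspaces of `B →₀ K`.
This is why a single scalar matrix describes a differential in all multidegrees. -/
lemma monomial_smul_homogenize {deg : B → Fin n → ℤ} {a : Fin n → ℤ} (m : Fin n →₀ ℕ) (c : K)
    {y : B →₀ K} (hy : y ∈ strand K deg a) :
    MvPolynomial.monomial m c • homogenize deg a y =
      c • homogenize deg ((fun i => (m i : ℤ)) + a) y := by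
  let f : (B →₀ K) →ₗ[K] (B →₀ MvPolynomial (Fin n) K) :=
    (LinearMap.lsmul _ _ (MvPolynomial.monomial m c)).restrictScalars K ∘ₗ homogenize deg a
  suffices h : strand K deg a ≤
      LinearMap.eqLocus f (c • homogenize deg ((fun i => (m i : ℤ)) + a)) from h hy
  refine strand_induction fun b hb => ?_
  have : m + expSub a (deg b) = expSub ((fun i => (m i : ℤ)) + a) (deg b) := by
    ext i
    have : deg b i ≤ a i := hb i
    simp only [expSub, Finsupp.coe_add, Pi.add_apply,
      Finsupp.equivFunOnFinite_symm_apply_apply]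
    omega
  rw [LinearMap.mem_eqLocus]
  simp [f, homogenize_single, MvPolynomial.monomial_mul, this, Finsupp.smul_single,
    MvPolynomial.smul_monomial]

/-- The `S`-linear map `d` is multigraded, and it is given by the matrix of scalars `δ`. -/
def IsHomogenization (deg' : B' → Fin n → ℤ) (deg : B → Fin n → ℤ)
    (d : (B' →₀ MvPolynomial (Fin n) K) →ₗ[MvPolynomial (Fin n) K]
      (B →₀ MvPolynomial (Fin n) K)) (δ : (B' →₀ K) →ₗ[K] (B →₀ K)) : Prop :=
  ∀ g, δ (Finsupp.single g 1) ∈ strand K deg (deg' g) ∧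
    d (Finsupp.single g 1) = homogenize deg (deg' g) (δ (Finsupp.single g 1))

/-! ### Kernels and images of multigraded maps, strand by strand -/

namespace IsHomogenization

variable {deg' : B' → Fin n → ℤ} {deg : B → Fin n → ℤ}
  {d : (B' →₀ MvPolynomial (Fin n) K) →ₗ[MvPolynomial (Fin n) K] (B →₀ MvPolynomial (Fin n) K)}
  {δ : (B' →₀ K) →ₗ[K] (B →₀ K)}

lemma map_mem_strand (h : IsHomogenization deg' deg d δ) {a : Fin n → ℤ} {y : B' →₀ K}
    (hy : y ∈ strand K deg' a) : δ y ∈ strand K deg a := by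
  suffices hs : strand K deg' a ≤ (strand K deg a).comap δ from hs hy
  exact strand_induction fun b hb => strand_mono hb (h b).1

lemma component_map (h : IsHomogenization deg' deg d δ) (a : Fin n → ℤ)
    (x : B' →₀ MvPolynomial (Fin n) K) : component deg a (d x) = δ (component deg' a x) := by
  classical
  suffices hs : component deg a ∘ₗ d.restrictScalars K = δ ∘ₗ component deg' a from
    LinearMap.congr_fun hs x
  refine linearMap_ext_single_monomial fun b m c => ?_
  have h1 : Finsupp.single b (MvPolynomial.monomial m c) =
      MvPolynomial.monomial m c • Finsupp.single b (1 : MvPolynomial (Fin n) K) := by simp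
  have h2 := (h b).1
  rw [LinearMap.comp_apply, LinearMap.comp_apply, component_single_monomial,
    LinearMap.restrictScalars_apply, h1, map_smul, (h b).2, monomial_smul_homogenize m c h2,
    map_smul, component_homogenize a (strand_mono (le_natCast_add m _) h2)]
  split_ifs
  · rw [← map_smul, Finsupp.smul_single, smul_eq_mul, mul_one]
  · simp

lemma map_eq_zero_iff (h : IsHomogenization deg' deg d δ) (x : B' →₀ MvPolynomial (Fin n) K) :
    d x = 0 ↔ ∀ a, δ (component deg' a x) = 0 := by
  constructor
  · intro hx a
    rw [← h.component_map, hx, map_zero]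
  · intro hx
    refine eq_of_component_eq deg fun a => ?_
    rw [h.component_map, hx, map_zero]

/-- Preimages are chosen in each multidegree separately; only finitely many components of `z` are
nonzero, so their sum makes sense. -/
lemma mem_range_iff (h : IsHomogenization deg' deg d δ) (z : B →₀ MvPolynomial (Fin n) K) :
    z ∈ LinearMap.range d ↔ ∀ a, ∃ w ∈ strand K deg' a, δ w = component deg a z := by
  classical
  constructor
  · rintro ⟨x, rfl⟩ a
    exact ⟨_, component_mem_strand deg' a x, (h.component_map a x).symm⟩
  · intro hz
    choose w hw hwz using hz
    obtain ⟨Z, hZ⟩ := exists_finset_component_eq_zero deg z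
    refine ⟨∑ a ∈ Z, homogenize deg' a (w a), eq_of_component_eq deg fun c => ?_⟩
    rw [h.component_map, map_sum, map_sum]
    simp_rw [component_homogenize c (hw _), apply_ite δ, map_zero]
    rw [Finset.sum_ite_eq', hwz]
    split_ifs with hc
    · rfl
    · rw [hZ c hc]

lemma homogenize_map (h : IsHomogenization deg' deg d δ) {a : Fin n → ℤ} {y : B' →₀ K}
    (hy : y ∈ strand K deg' a) : d (homogenize deg' a y) = homogenize deg a (δ y) := by
  classical
  refine eq_of_component_eq deg fun c => ?_
  rw [h.component_map, component_homogenize c hy, component_homogenize c (h.map_mem_strand hy),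
    apply_ite δ, map_zero]

lemma homogenize_mem_range_iff (h : IsHomogenization deg' deg d δ) {a : Fin n → ℤ} {y : B →₀ K}
    (hy : y ∈ strand K deg a) :
    homogenize deg a y ∈ LinearMap.range d ↔ ∃ w ∈ strand K deg' a, δ w = y := by
  classical
  constructor
  · intro hm
    obtain ⟨w, hw, hwy⟩ := (h.mem_range_iff _).1 hm a
    rw [component_homogenize a hy, if_pos rfl] at hwy
    exact ⟨w, hw, hwy⟩
  · rintro ⟨w, hw, rfl⟩
    exact ⟨_, h.homogenize_map hw⟩

lemma isHomogeneousOfDegree_map (h : IsHomogenization deg' deg d δ) {a : Fin n → ℤ}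
    {x : B' →₀ MvPolynomial (Fin n) K} (hx : IsHomogeneousOfDegree deg' a x) :
    IsHomogeneousOfDegree deg a (d x) := by
  rw [isHomogeneousOfDegree_iff] at hx ⊢
  intro c hc
  rw [h.component_map, hx c hc, map_zero]

end IsHomogenization

/-! ### The augmentation and membership in monomial ideals -/

/-- The multigraded map `∑ p_b b ↦ ∑ p_b c_b x ^ deg b` to the polynomial ring. -/
noncomputable def augment (deg : B → Fin n → ℤ) (c : B → K) :
    (B →₀ MvPolynomial (Fin n) K) →ₗ[MvPolynomial (Fin n) K] MvPolynomial (Fin n) K :=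
  Finsupp.linearCombination _ fun b => MvPolynomial.monomial (expSub (deg b) 0) (c b)

lemma coeff_augment {deg : B → Fin n → ℤ} {c : B → K} (hc : ∀ b, c b ≠ 0 → 0 ≤ deg b)
    (m : Fin n →₀ ℕ) (x : B →₀ MvPolynomial (Fin n) K) :
    (augment deg c x).coeff m =
      Finsupp.linearCombination K c (component deg (fun i => (m i : ℤ)) x) := by
  classical
  suffices hs : MvPolynomial.lcoeff K m ∘ₗ (augment deg c).restrictScalars K =
      Finsupp.linearCombination K c ∘ₗ component deg (fun i => (m i : ℤ)) from
    LinearMap.congr_fun hs x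
  refine linearMap_ext_single_monomial fun b m' k => ?_
  simp only [LinearMap.comp_apply, component_single_monomial, LinearMap.restrictScalars_apply,
    augment, Finsupp.linearCombination_single, smul_eq_mul, MvPolynomial.monomial_mul,
    MvPolynomial.lcoeff_apply, MvPolynomial.coeff_monomial]
  by_cases hb : c b = 0
  · split_ifs <;> simp [hb]
  · have h0 := hc b hb
    have : m' + expSub (deg b) 0 = m ↔ (fun i => (m' i : ℤ)) + deg b = fun i => (m i : ℤ) := by
      constructor
      · rintro rfl
        funext i
        simpa [expSub] using h0 i
      · intro e
        ext i
        have := congrFun e i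
        have : 0 ≤ deg b i := h0 i
        simp only [expSub, Finsupp.coe_add, Pi.add_apply, Pi.zero_apply,
          Finsupp.equivFunOnFinite_symm_apply_apply] at *
        omega
    rw [apply_ite (Finsupp.linearCombination K c), map_zero, Finsupp.linearCombination_single]
    simp only [this, smul_eq_mul]

/-- The component of multidegree `a` of the quotient by the ideal generated by the monomials
with exponent vectors in `A` vanishes. -/
def QuotVanishes (A : Set (Fin n →₀ ℕ)) (a : Fin n → ℤ) : Prop :=
  0 ≤ a → ∃ s ∈ A, (fun i => (s i : ℤ)) ≤ a

lemma quotVanishes_union {A A' : Set (Fin n →₀ ℕ)} {a : Fin n → ℤ} :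
    QuotVanishes (A ∪ A') a ↔ QuotVanishes A a ∨ QuotVanishes A' a := by
  unfold QuotVanishes
  by_cases h : 0 ≤ a
  · simp only [h, true_imp_iff, Set.mem_union, or_and_right, exists_or]
  · simp [h]

/-- A polynomial lies in a monomial ideal iff each of its monomials does, and the coefficient of `x
^ m` only sees the component of multidegree `m`. Degrees with a negative entry impose nothing, since
`QuotVanishes` holds there vacuously. -/
lemma mem_span_monomial_iff_component {deg : B → Fin n → ℤ} {c : B → K}
    (hc : ∀ b, c b ≠ 0 → 0 ≤ deg b) (A : Set (Fin n →₀ ℕ)) (x : B →₀ MvPolynomial (Fin n) K) :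
    augment deg c x ∈ Ideal.span ((fun m => MvPolynomial.monomial m (1 : K)) '' A) ↔
      ∀ a, Finsupp.linearCombination K c (component deg a x) = 0 ∨ QuotVanishes A a := by
  rw [MvPolynomial.mem_ideal_span_monomial_image]
  constructor
  · intro h a
    rw [or_iff_not_imp_left]
    intro hne h0
    have ha : (fun i => (((expSub a 0) i : ℕ) : ℤ)) = a := by
      have := (expSub_eq_iff h0 _).1 rfl
      rwa [add_zero] at this
    obtain ⟨s, hs, hsa⟩ := h (expSub a 0) (by
      rwa [MvPolynomial.mem_support_iff, coeff_augment hc, ha])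
    refine ⟨s, hs, ?_⟩
    rw [← ha]
    exact fun i => Int.ofNat_le.2 (hsa i)
  · intro h m hm
    rw [MvPolynomial.mem_support_iff, coeff_augment hc] at hm
    obtain ⟨s, hs, hsm⟩ := (h _).resolve_left hm (fun i => Int.natCast_nonneg _)
    exact ⟨s, hs, fun i => Int.ofNat_le.1 (hsm i)⟩

end Strands

end LcmTensor

namespace LcmTensor

/-! ### Contracting a complex of vector spaces onto its homology -/

section Contraction

variable {K : Type*} [Field K]

/-- Over a field, a section of `f` onto its range extends from the range to all of `W`. -/
lemma exists_generalized_inverse {V W : Type*} [AddCommGroup V] [Module K V] [AddCommGroup W]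
    [Module K W] (f : V →ₗ[K] W) : ∃ g : W →ₗ[K] V, ∀ x, f (g (f x)) = f x := by
  obtain ⟨r, hr⟩ := f.rangeRestrict.exists_rightInverse_of_surjective f.range_rangeRestrict
  obtain ⟨g, hg⟩ := LinearMap.exists_extend r
  refine ⟨g, fun x => ?_⟩
  have h1 : g (f x) = r (f.rangeRestrict x) := LinearMap.congr_fun hg (f.rangeRestrict x)
  have h2 := congrArg Subtype.val (LinearMap.congr_fun hr (f.rangeRestrict x))
  rw [h1]
  exact h2

variable {C : ℕ → Type*} [∀ i, AddCommGroup (C i)] [∀ i, Module K (C i)]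

/-- A contraction of the complex of subspaces `V i` with differential `δ` onto its homology in
degree zero, which is detected by the functional `c` (and vanishes if `Q` holds). -/
structure Contraction (V : ∀ i, Submodule K (C i)) (δ : ∀ i, C (i + 1) →ₗ[K] C i)
    (c : C 0 →ₗ[K] K) (Q : Prop) where
  /-- the homotopy -/
  h : ∀ i, C i →ₗ[K] C (i + 1)
  /-- a generator of the homology in degree zero -/
  v : C 0
  h_mem : ∀ i x, x ∈ V i → h i x ∈ V (i + 1)
  v_mem : v ∈ V 0
  d_h_zero : ∀ x ∈ V 0, δ 0 (h 0 x) = x - c x • v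
  d_h_succ : ∀ i, ∀ x ∈ V (i + 1), δ (i + 1) (h (i + 1) x) + h i (δ i x) = x
  c_d_smul : ∀ x ∈ V 1, c (δ 0 x) • v = 0
  v_eq_zero : Q → v = 0

/-- The generalized inverses `s i` satisfy `δ s δ = δ`, so `x - s (δ x)` is a cycle, hence a
boundary, and `δ s` fixes boundaries. This gives the homotopy `s (1 - s δ)` in positive degrees. -/
lemma nonempty_contraction {V : ∀ i, Submodule K (C i)} {δ : ∀ i, C (i + 1) →ₗ[K] C i}
    {c : C 0 →ₗ[K] K} {Q : Prop} (hV : ∀ i, ∀ x ∈ V (i + 1), δ i x ∈ V i)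
    (hd : ∀ i x, δ i (δ (i + 1) x) = 0)
    (hex : ∀ i, ∀ x ∈ V (i + 1), δ i x = 0 → ∃ w ∈ V (i + 2), δ (i + 1) w = x)
    (h0 : ∀ x ∈ V 0, (∃ w ∈ V 1, δ 0 w = x) ↔ c x = 0 ∨ Q) :
    Nonempty (Contraction V δ c Q) := by
  have hs : ∀ i, ∃ s : C i →ₗ[K] C (i + 1), (∀ x, s x ∈ V (i + 1)) ∧
      ∀ w ∈ V (i + 1), δ i (s (δ i w)) = δ i w := by
    intro i
    obtain ⟨g, hg⟩ := exists_generalized_inverse (δ i ∘ₗ (V (i + 1)).subtype)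
    exact ⟨(V (i + 1)).subtype ∘ₗ g, fun x => (g x).2, fun w hw => hg ⟨w, hw⟩⟩
  choose s hsV hs using hs
  let h : ∀ i, C i →ₗ[K] C (i + 1)
    | 0 => s 0
    | i + 1 => s (i + 1) ∘ₗ (LinearMap.id - s i ∘ₗ δ i)
  have hmem : ∀ i x, h i x ∈ V (i + 1) := by
    rintro (_ | i) x
    · exact hsV _ _
    · exact hsV _ _
  have hhd : ∀ i x, h i (δ i x) = s i (δ i x) := by
    rintro (_ | i) x
    · rfl
    · simp [h, hd]
  have hsucc : ∀ i, ∀ x ∈ V (i + 1), δ (i + 1) (h (i + 1) x) + h i (δ i x) = x := by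
    intro i x hx
    obtain ⟨w, hw, hwx⟩ := hex i (x - s i (δ i x)) (sub_mem hx (hsV _ _)) (by
      rw [map_sub, hs i x hx, sub_self])
    have : h (i + 1) x = s (i + 1) (δ (i + 1) w) := by rw [hwx]; rfl
    rw [hhd, this, hs _ w hw, hwx, sub_add_cancel]
  have hker : ∀ x ∈ V 0, c x = 0 ∨ Q → δ 0 (s 0 x) = x := by
    intro x hx hc
    obtain ⟨w, hw, rfl⟩ := (h0 x hx).2 hc
    exact hs 0 w hw
  -- If `Q` holds or `c` vanishes on `V 0`, every element of `V 0` is a boundary and `v = 0` works.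
  by_cases hc : Q ∨ ∀ x ∈ V 0, c x = 0
  · refine ⟨⟨h, 0, fun i x _ => hmem i x, zero_mem _, fun x hx => ?_, hsucc,
      fun x _ => smul_zero _, fun _ => rfl⟩⟩
    rw [smul_zero, sub_zero]
    exact hker x hx (hc.symm.imp_left fun h => h x hx)
  · push Not at hc
    obtain ⟨hQ, u, hu, hcu⟩ := hc
    -- The generator is `u` scaled to `c = 1` and corrected by a boundary; the formula for `δ (s x)`
    -- then comes from `x - (c x / c u) • u`, which lies in the kernel of `c` and is therefore a
    -- boundary.
    refine ⟨⟨h, (c u)⁻¹ • (u - δ 0 (s 0 u)), fun i x _ => hmem i x,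
      Submodule.smul_mem _ _ (sub_mem hu (hV _ _ (hsV _ _))), fun x hx => ?_, hsucc,
      fun x hx => ?_, fun h => absurd h hQ⟩⟩
    · have hz := hker (x - (c x * (c u)⁻¹) • u) (sub_mem hx (Submodule.smul_mem _ _ hu))
        (Or.inl (by simp [mul_assoc, inv_mul_cancel₀ hcu]))
      simp only [map_sub, map_smul] at hz
      change δ 0 (s 0 x) = _
      rw [eq_sub_iff_add_eq, smul_smul, smul_sub]
      rw [sub_eq_iff_eq_add] at hz
      rw [hz]
      abel
    · rw [((h0 _ (hV 0 x hx)).1 ⟨x, hx, rfl⟩).resolve_right hQ, zero_smul]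

end Contraction

/-! ### Translating between multigraded resolutions and strand data -/

namespace FreeSequence

variable {K : Type*} [Field K] {n : ℕ}

/-- The matrix of the scalars of the differential of a sequence of free modules. -/
noncomputable def scalarMap (F : FreeSequence K n) (i : ℕ) :
    (F.B (i + 1) →₀ K) →ₗ[K] (F.B i →₀ K) :=
  Finsupp.linearCombination K fun g =>
    ∑ h ∈ (F.d i (Finsupp.single g 1)).support, Finsupp.single h (F.scalar i g h)

lemma scalarMap_single (F : FreeSequence K n) (i : ℕ) (g : F.B (i + 1)) :
    F.scalarMap i (Finsupp.single g 1) =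
      ∑ h ∈ (F.d i (Finsupp.single g 1)).support, Finsupp.single h (F.scalar i g h) := by
  simp [scalarMap]

/-- A resolution of the quotient by a monomial ideal, described in terms of its strands: the
scalar matrices `δ`, and the scalars `c` of the augmentation. -/
structure StrandResolution (F : FreeSequence K n) (A : Set (Fin n →₀ ℕ))
    (δ : ∀ i, (F.B (i + 1) →₀ K) →ₗ[K] (F.B i →₀ K)) (c : F.B 0 → K) : Prop where
  isHomogenization : ∀ i, IsHomogenization (F.deg (i + 1)) (F.deg i) (F.d i) (δ i)
  d_comp_d : ∀ i x, δ i (δ (i + 1) x) = 0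
  exact : ∀ a i, ∀ x ∈ strand K (F.deg (i + 1)) a, δ i x = 0 →
    ∃ w ∈ strand K (F.deg (i + 2)) a, δ (i + 1) w = x
  exact_zero : ∀ a, ∀ x ∈ strand K (F.deg 0) a, (∃ w ∈ strand K (F.deg 1) a, δ 0 w = x) ↔
    Finsupp.linearCombination K c x = 0 ∨ QuotVanishes A a
  nonneg : ∀ b, c b ≠ 0 → 0 ≤ F.deg 0 b
  surj : QuotVanishes A 0 ∨ ∃ b, c b ≠ 0 ∧ F.deg 0 b = 0

namespace StrandResolution

variable {F : FreeSequence K n} {A : Set (Fin n →₀ ℕ)}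
  {δ : ∀ i, (F.B (i + 1) →₀ K) →ₗ[K] (F.B i →₀ K)} {c : F.B 0 → K}

lemma nonempty_contraction (h : F.StrandResolution A δ c) (a : Fin n → ℤ) :
    Nonempty (Contraction (fun i => strand K (F.deg i) a) δ (Finsupp.linearCombination K c)
      (QuotVanishes A a)) :=
  LcmTensor.nonempty_contraction (fun i _ hx => (h.isHomogenization i).map_mem_strand hx)
    h.d_comp_d (h.exact a) (h.exact_zero a)

lemma isMultigradedFreeResolution (h : F.StrandResolution A δ c) :
    F.IsMultigradedFreeResolution
      (Ideal.span ((fun m => MvPolynomial.monomial m (1 : K)) '' A)) := by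
  have hdd : ∀ i x, F.d i (F.d (i + 1) x) = 0 := by
    intro i x
    rw [(h.isHomogenization i).map_eq_zero_iff]
    intro a
    rw [(h.isHomogenization (i + 1)).component_map, h.d_comp_d]
  refine ⟨fun i a x => (h.isHomogenization i).isHomogeneousOfDegree_map,
    fun i => LinearMap.ext (hdd i), fun i x => ⟨fun hx => ?_, ?_⟩, ?_⟩
  · refine ((h.isHomogenization (i + 1)).mem_range_iff x).2 fun a => ?_
    exact h.exact a i _ (component_mem_strand _ _ _)
      (((h.isHomogenization i).map_eq_zero_iff x).1 hx a)
  · rintro ⟨w, rfl⟩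
    exact hdd i w
  set I := Ideal.span ((fun m => MvPolynomial.monomial m (1 : K)) '' A) with hI
  refine ⟨(I.mkQ) ∘ₗ augment (F.deg 0) c, ?_, ?_, ?_⟩
  · rw [← LinearMap.range_eq_top]
    suffices h1 : ∃ x, (I.mkQ ∘ₗ augment (F.deg 0) c) x = I.mkQ 1 by
      obtain ⟨x, hx⟩ := h1
      rw [eq_top_iff]
      rintro y -
      obtain ⟨p, rfl⟩ := I.mkQ_surjective y
      refine ⟨p • x, ?_⟩
      rw [map_smul, hx, ← map_smul, smul_eq_mul, mul_one]
    rcases h.surj with h0 | ⟨b, hb, hdeg⟩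
    · refine ⟨0, ?_⟩
      rw [map_zero, eq_comm, Submodule.mkQ_apply, Submodule.Quotient.mk_eq_zero, hI,
        MvPolynomial.mem_ideal_span_monomial_image]
      intro m hm
      obtain ⟨s, hs, hs0⟩ := h0 le_rfl
      refine ⟨s, hs, fun i => ?_⟩
      have : (s i : ℤ) ≤ 0 := hs0 i
      omega
    · refine ⟨Finsupp.single b (MvPolynomial.C (c b)⁻¹), ?_⟩
      have : expSub (0 : Fin n → ℤ) 0 = 0 := by ext; simp [expSub]
      rw [LinearMap.comp_apply, augment, Finsupp.linearCombination_single, hdeg, this,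
        smul_eq_mul, MvPolynomial.C_mul_monomial, inv_mul_cancel₀ hb]
      rfl
  · intro z
    rw [LinearMap.comp_apply, Submodule.mkQ_apply, Submodule.Quotient.mk_eq_zero, hI,
      mem_span_monomial_iff_component h.nonneg]
    refine Iff.trans ?_ ((h.isHomogenization 0).mem_range_iff z).symm
    exact forall_congr' fun a => (h.exact_zero a _ (component_mem_strand _ _ _)).symm
  · intro a x hx
    refine ⟨augment (F.deg 0) c x, fun m hm => ?_, rfl⟩
    by_contra hne
    rw [MvPolynomial.mem_support_iff, coeff_augment h.nonneg,
      (isHomogeneousOfDegree_iff _ _ _).1 hx _ hne, map_zero] at hm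
    exact hm rfl

end StrandResolution

lemma isHomogeneousOfDegree_single {B : Type*} (deg : B → Fin n → ℤ) (b : B) :
    IsHomogeneousOfDegree deg (deg b) (Finsupp.single b (1 : MvPolynomial (Fin n) K)) := by
  classical
  intro b' m hm
  by_cases hb : b = b'
  · subst hb
    rw [Finsupp.single_eq_same, MvPolynomial.mem_support_iff, MvPolynomial.coeff_one] at hm
    have : m = 0 := by
      by_contra h
      simp [Ne.symm h] at hm
    subst this
    funext i
    simp
  · simp [hb] at hm

lemma eq_monomial_of_support {m : Fin n →₀ ℕ} {p : MvPolynomial (Fin n) K}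
    (h : ∀ m' ∈ p.support, m' = m) : p = MvPolynomial.monomial m (p.coeff m) := by
  classical
  ext m'
  rw [MvPolynomial.coeff_monomial]
  split_ifs with he
  · rw [he]
  · by_contra hne
    exact he (h m' (MvPolynomial.mem_support_iff.2 hne)).symm

namespace IsMultigradedFreeResolution

variable {F : FreeSequence K n} {I : Ideal (MvPolynomial (Fin n) K)}

lemma isHomogenization (hF : F.IsMultigradedFreeResolution I) (i : ℕ) :
    IsHomogenization (F.deg (i + 1)) (F.deg i) (F.d i) (F.scalarMap i) := by
  intro g
  have hg := hF.homogeneous i _ _ (isHomogeneousOfDegree_single (K := K) (F.deg (i + 1)) g)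
  have hle : ∀ h ∈ (F.d i (Finsupp.single g 1)).support, F.deg i h ≤ F.deg (i + 1) g := by
    intro h hh
    obtain ⟨m, hm⟩ := MvPolynomial.support_nonempty.2 (Finsupp.mem_support_iff.1 hh)
    rw [← hg h m hm]
    exact le_natCast_add m _
  rw [scalarMap_single]
  refine ⟨sum_mem fun h hh => single_mem_strand (hle h hh) _, ?_⟩
  rw [map_sum]
  simp_rw [homogenize_single]
  conv_lhs => rw [← Finsupp.sum_single (F.d i (Finsupp.single g 1))]
  refine Finset.sum_congr rfl fun h hh => ?_
  congr 1
  exact eq_monomial_of_support fun m hm =>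
    ((expSub_eq_iff (hle h hh) m).2 (hg h m hm)).symm

/-- By homogeneity `ε` sends a basis element `b` to a scalar multiple of `x ^ deg b` modulo the
ideal, so `ε` is recorded by scalars `c`. The other conditions are exactness read in a fixed
multidegree. -/
lemma exists_strandResolution {A : Set (Fin n →₀ ℕ)} (hF : F.IsMultigradedFreeResolution
      (Ideal.span ((fun m => MvPolynomial.monomial m (1 : K)) '' A))) :
    ∃ c, F.StrandResolution A F.scalarMap c := by
  classical
  have hd := hF.isHomogenization
  set I := Ideal.span ((fun m => MvPolynomial.monomial m (1 : K)) '' A) with hI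
  obtain ⟨ε, hε, hex, hhom⟩ := hF.augmentation
  have hc : ∀ b, ∃ k : K, (k ≠ 0 → 0 ≤ F.deg 0 b) ∧
      ε (Finsupp.single b 1) = I.mkQ (MvPolynomial.monomial (expSub (F.deg 0 b) 0) k) := by
    intro b
    obtain ⟨p, hp, hpb⟩ := hhom _ _ (isHomogeneousOfDegree_single (K := K) (F.deg 0) b)
    by_cases h0 : 0 ≤ F.deg 0 b
    · refine ⟨p.coeff (expSub (F.deg 0 b) 0), fun _ => h0, ?_⟩
      rw [← hpb]
      refine congrArg I.mkQ (eq_monomial_of_support fun m hm => ?_)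
      rw [eq_comm, expSub_eq_iff h0, add_zero]
      exact hp m hm
    -- A degree with a negative entry carries no monomials, so the image of `b` is zero.
    · refine ⟨0, fun h => absurd rfl h, ?_⟩
      have : p = 0 := by
        rw [← MvPolynomial.support_eq_empty, Finset.eq_empty_iff_forall_notMem]
        intro m hm
        exact h0 (hp m hm ▸ fun i => Int.natCast_nonneg _)
      rw [← hpb, this, map_zero, map_zero, map_zero]
  choose c hc0 hc using hc
  have hεc : ε = I.mkQ ∘ₗ augment (F.deg 0) c := by
    refine Finsupp.lhom_ext' fun b => LinearMap.ext_ring ?_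
    simp [augment, hc]
  refine ⟨c, hd, fun i x => ?_, fun a i x hx h0 => ?_, fun a x hx => ?_, hc0, ?_⟩
  · refine Finsupp.induction_linear x ?_ ?_ ?_
    · simp
    · intro x y hx hy
      simp only [map_add, hx, hy, add_zero]
    · intro b k
      have hb : Finsupp.single b k ∈ strand K (F.deg (i + 1 + 1)) (F.deg _ b) :=
        single_mem_strand le_rfl k
      have hb' := (hd (i + 1)).map_mem_strand hb
      have hb'' := (hd i).map_mem_strand hb'
      have := component_homogenize (F.deg _ b) hb''
      rw [if_pos rfl, ← (hd i).homogenize_map hb', ← (hd (i + 1)).homogenize_map hb,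
        ← LinearMap.comp_apply, hF.d_comp_d, LinearMap.zero_apply, map_zero] at this
      exact this.symm
  · rw [← (hd (i + 1)).homogenize_mem_range_iff hx]
    apply (hF.acyclic i _).1
    rw [(hd i).homogenize_map hx, h0, map_zero]
  · rw [← (hd 0).homogenize_mem_range_iff hx]
    refine (hex _).symm.trans ?_
    rw [hεc, LinearMap.comp_apply, Submodule.mkQ_apply, Submodule.Quotient.mk_eq_zero, hI,
      mem_span_monomial_iff_component hc0]
    refine ⟨fun h => ?_, fun h b => ?_⟩
    · have := h a
      rwa [component_homogenize a hx, if_pos rfl] at this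
    · rw [component_homogenize b hx]
      split_ifs with hab
      · rwa [← hab]
      · exact Or.inl (map_zero _)
  · rw [or_iff_not_imp_left]
    intro hv
    obtain ⟨w, hw⟩ := hε (I.mkQ 1)
    by_contra hno
    rw [hεc, LinearMap.comp_apply, ← sub_eq_zero, ← map_sub, Submodule.mkQ_apply,
      Submodule.Quotient.mk_eq_zero, hI, MvPolynomial.mem_ideal_span_monomial_image] at hw
    -- Without a degree-zero `b` having `c b ≠ 0`, the lift of `1` has no constant term. So `1`
    -- occurs in an element of the ideal, and some generator must be `1`.
    have h0 : (augment (F.deg 0) c w).coeff 0 = 0 := by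
      rw [coeff_augment hc0, Finsupp.linearCombination_apply]
      refine Finset.sum_eq_zero fun b hb => ?_
      by_cases hcb : c b = 0
      · simp [hcb]
      · have h1 := (mem_strand.1 (component_mem_strand (F.deg 0) _ w)) b
          (Finsupp.mem_support_iff.1 hb)
        exact absurd ⟨b, hcb, le_antisymm (fun i => by simpa using h1 i) (hc0 b hcb)⟩ hno
    obtain ⟨s, hs, hs0⟩ := hw 0 (by simp [h0])
    refine hv fun _ => ⟨s, hs, fun i => ?_⟩
    have := hs0 i
    simp at this
    simp [this]

end IsMultigradedFreeResolution

end FreeSequence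

end LcmTensor

namespace LcmTensor

lemma bilinear_ext {K M X Y : Type*} [Field K] [AddCommGroup M] [Module K M]
    {f g : (X →₀ K) →ₗ[K] (Y →₀ K) →ₗ[K] M}
    (h : ∀ x y, f (Finsupp.single x 1) (Finsupp.single y 1) =
      g (Finsupp.single x 1) (Finsupp.single y 1)) : f = g :=
  Finsupp.lhom_ext' fun x => LinearMap.ext_ring <|
    Finsupp.lhom_ext' fun y => LinearMap.ext_ring <| h x y

namespace FreeSequence

variable {K : Type*} [Field K] {n : ℕ} (F G : FreeSequence K n)

/-! ### The scalar complex of `F * G` as a tensor product -/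

section Product

variable {F G} {i j k : ℕ}

/-- The bilinear map `(g, e) ↦ g * e`. -/
noncomputable def starMul (hjk : j + k = i) :
    (F.B j →₀ K) →ₗ[K] (G.B k →₀ K) →ₗ[K] (StarBasis F G i →₀ K) :=
  Finsupp.linearCombination K fun g =>
    Finsupp.lmapDomain K K fun e => (⟨j, k, g, e, hjk⟩ : StarBasis F G i)

lemma starMul_single (hjk : j + k = i) (g : F.B j) (e : G.B k) (a b : K) :
    starMul hjk (Finsupp.single g a) (Finsupp.single e b) =
      Finsupp.single (⟨j, k, g, e, hjk⟩ : StarBasis F G i) (a * b) := by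
  simp [starMul, Finsupp.mapDomain_single]

lemma single_eq_starMul (b : StarBasis F G i) :
    Finsupp.single b (1 : K) =
      starMul b.add_eq (Finsupp.single b.left 1) (Finsupp.single b.right 1) := by
  rw [starMul_single, one_mul]

/-- This is where the lcm enters: `deg g ⊔ deg e ≤ a` as soon as both degrees are at most `a`. -/
lemma starMul_mem_strand {hjk : j + k = i} {a : Fin n → ℤ} {x : F.B j →₀ K} {y : G.B k →₀ K}
    (hx : x ∈ strand K (F.deg j) a) (hy : y ∈ strand K (G.deg k) a) :
    starMul hjk x y ∈ strand K (StarBasis.deg (F := F) (G := G) (i := i)) a := by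
  suffices h : strand K (F.deg j) a ≤
      (strand K (StarBasis.deg (F := F) (G := G) (i := i)) a).comap ((starMul hjk).flip y) from h hx
  refine strand_induction fun g hg => ?_
  suffices h : strand K (G.deg k) a ≤
      (strand K (StarBasis.deg (F := F) (G := G) (i := i)) a).comap (starMul hjk (Finsupp.single g 1)) from h hy
  refine strand_induction fun e he => ?_
  rw [Submodule.mem_comap, starMul_single]
  exact single_mem_strand (deg := StarBasis.deg (F := F) (G := G)) (sup_le hg he) _

variable (F G) in
/-- The scalars of `starLeft`. -/
noncomputable def starScalarLeft (i : ℕ) : (j k : ℕ) → (g : F.B j) → (e : G.B k) →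
    j + k = i + 1 → (StarBasis F G i →₀ K)
  | 0, _, _, _, _ => 0
  | j + 1, k, g, e, hjk =>
    starMul (by omega : j + k = i) (F.scalarMap j (Finsupp.single g 1)) (Finsupp.single e 1)

variable (F G) in
/-- The scalars of `starRight`. -/
noncomputable def starScalarRight (i : ℕ) : (j k : ℕ) → (g : F.B j) → (e : G.B k) →
    j + k = i + 1 → (StarBasis F G i →₀ K)
  | _, 0, _, _, _ => 0
  | j, k + 1, g, e, hjk =>
    starMul (by omega : j + k = i) (Finsupp.single g 1) (G.scalarMap k (Finsupp.single e 1))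

variable (F G) in
/-- The matrix of scalars of the differential of `F * G`. -/
noncomputable def starScalarMap (i : ℕ) :
    (StarBasis F G (i + 1) →₀ K) →ₗ[K] (StarBasis F G i →₀ K) :=
  Finsupp.linearCombination K fun b =>
    starScalarLeft F G i b.j b.k b.left b.right b.add_eq +
      (-1 : K) ^ b.j • starScalarRight F G i b.j b.k b.left b.right b.add_eq

lemma starScalarMap_single (b : StarBasis F G (i + 1)) :
    starScalarMap F G i (Finsupp.single b 1) =
      starScalarLeft F G i b.j b.k b.left b.right b.add_eq +
        (-1 : K) ^ b.j • starScalarRight F G i b.j b.k b.left b.right b.add_eq := by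
  simp [starScalarMap]

lemma starScalarMap_starMul_succ_zero (hjk : j + 1 + 0 = i + 1) (x : F.B (j + 1) →₀ K)
    (y : G.B 0 →₀ K) :
    starScalarMap F G i (starMul hjk x y) =
      starMul (by omega : j + 0 = i) (F.scalarMap j x) y := by
  suffices h : (starMul hjk).compr₂ (starScalarMap F G i) =
      (starMul (F := F) (G := G) (by omega : j + 0 = i)).comp (F.scalarMap j) from
    LinearMap.congr_fun₂ h x y
  refine bilinear_ext fun g e => ?_
  simp only [LinearMap.compr₂_apply, LinearMap.comp_apply]
  rw [starMul_single, one_mul, starScalarMap_single]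
  simp [starScalarLeft, starScalarRight]

lemma starScalarMap_starMul_zero_succ (hjk : 0 + (k + 1) = i + 1) (x : F.B 0 →₀ K)
    (y : G.B (k + 1) →₀ K) :
    starScalarMap F G i (starMul hjk x y) =
      starMul (by omega : 0 + k = i) x (G.scalarMap k y) := by
  suffices h : (starMul hjk).compr₂ (starScalarMap F G i) =
      (starMul (F := F) (G := G) (by omega : 0 + k = i)).compl₂ (G.scalarMap k) from
    LinearMap.congr_fun₂ h x y
  refine bilinear_ext fun g e => ?_
  simp only [LinearMap.compr₂_apply, LinearMap.compl₂_apply]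
  rw [starMul_single, one_mul, starScalarMap_single]
  simp [starScalarLeft, starScalarRight]

lemma starScalarMap_starMul_succ_succ (hjk : j + 1 + (k + 1) = i + 1) (x : F.B (j + 1) →₀ K)
    (y : G.B (k + 1) →₀ K) :
    starScalarMap F G i (starMul hjk x y) =
      starMul (by omega : j + (k + 1) = i) (F.scalarMap j x) y +
        (-1 : K) ^ (j + 1) • starMul (by omega : j + 1 + k = i) x (G.scalarMap k y) := by
  suffices h : (starMul hjk).compr₂ (starScalarMap F G i) =
      (starMul (F := F) (G := G) (by omega : j + (k + 1) = i)).comp (F.scalarMap j) +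
        (-1 : K) ^ (j + 1) • (starMul (F := F) (G := G)
          (by omega : j + 1 + k = i)).compl₂ (G.scalarMap k) from
    LinearMap.congr_fun₂ h x y
  refine bilinear_ext fun g e => ?_
  simp only [LinearMap.compr₂_apply, LinearMap.compl₂_apply, LinearMap.comp_apply,
    LinearMap.add_apply, LinearMap.smul_apply]
  rw [starMul_single, one_mul, starScalarMap_single]
  simp [starScalarLeft, starScalarRight]

lemma starScalarMap_starScalarMap (hF : ∀ i x, F.scalarMap i (F.scalarMap (i + 1) x) = 0)
    (hG : ∀ i x, G.scalarMap i (G.scalarMap (i + 1) x) = 0) (i : ℕ)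
    (z : StarBasis F G (i + 1 + 1) →₀ K) :
    starScalarMap F G i (starScalarMap F G (i + 1) z) = 0 := by
  suffices h : starScalarMap F G i ∘ₗ starScalarMap F G (i + 1) = 0 from LinearMap.congr_fun h z
  refine Finsupp.lhom_ext' fun b => LinearMap.ext_ring ?_
  simp only [LinearMap.comp_apply, Finsupp.lsingle_apply, LinearMap.zero_apply]
  rw [single_eq_starMul]
  obtain ⟨j, k, g, e, hjk⟩ := b
  dsimp only
  generalize Finsupp.single g (1 : K) = x
  generalize Finsupp.single e (1 : K) = y
  -- Applying the differential twice lowers an index by up to two, so the boundary cases `0` and `1`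
  -- are separate. The two mixed terms cancel by sign.
  rcases j with _ | _ | j <;> rcases k with _ | _ | k
  · omega
  · omega
  · rw [starScalarMap_starMul_zero_succ, starScalarMap_starMul_zero_succ, hG, map_zero]
  · omega
  · rw [starScalarMap_starMul_succ_succ, map_add, map_smul, starScalarMap_starMul_zero_succ,
      starScalarMap_starMul_succ_zero]
    simp
  · rw [starScalarMap_starMul_succ_succ, map_add, map_smul, starScalarMap_starMul_zero_succ,
      starScalarMap_starMul_succ_succ, hG]
    simp
  · rw [starScalarMap_starMul_succ_zero, starScalarMap_starMul_succ_zero, hF, map_zero,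
      LinearMap.zero_apply]
  · rw [starScalarMap_starMul_succ_succ, map_add, map_smul, starScalarMap_starMul_succ_succ,
      starScalarMap_starMul_succ_zero, hF]
    simp [pow_succ]
  · rw [starScalarMap_starMul_succ_succ, map_add, map_smul, starScalarMap_starMul_succ_succ,
      starScalarMap_starMul_succ_succ, hF, hG]
    simp [pow_succ]

variable (F G) in
lemma homogenize_starScalarLeft (j k : ℕ) (g : F.B j) (e : G.B k) (hjk : j + k = i + 1) :
    homogenize (StarBasis.deg (F := F) (G := G) (i := i)) (F.deg j g ⊔ G.deg k e) (starScalarLeft F G i j k g e hjk) =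
      starLeft F G i j k g e hjk := by
  rcases j with _ | j
  · exact map_zero _
  · simp only [starScalarLeft, starLeft, scalarMap_single, map_sum, LinearMap.sum_apply,
      starMul_single, mul_one]
    exact Finset.sum_congr rfl fun _ _ => homogenize_single (StarBasis.deg (F := F) (G := G)) _ _ _

variable (F G) in
lemma homogenize_starScalarRight (j k : ℕ) (g : F.B j) (e : G.B k) (hjk : j + k = i + 1) :
    homogenize (StarBasis.deg (F := F) (G := G) (i := i)) (F.deg j g ⊔ G.deg k e) (starScalarRight F G i j k g e hjk) =
      starRight F G i j k g e hjk := by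
  rcases k with _ | k
  · exact map_zero _
  · simp only [starScalarRight, starRight, scalarMap_single, map_sum,
      starMul_single, one_mul]
    exact Finset.sum_congr rfl fun _ _ => homogenize_single (StarBasis.deg (F := F) (G := G)) _ _ _

lemma isHomogenization_star
    (hF : ∀ i, IsHomogenization (F.deg (i + 1)) (F.deg i) (F.d i) (F.scalarMap i))
    (hG : ∀ i, IsHomogenization (G.deg (i + 1)) (G.deg i) (G.d i) (G.scalarMap i)) (i : ℕ) :
    IsHomogenization (StarBasis.deg (F := F) (G := G) (i := i + 1))
      (StarBasis.deg (F := F) (G := G) (i := i)) ((F.star G).d i) (starScalarMap F G i) := by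
  rintro ⟨j, k, g, e, hjk⟩
  have hg : Finsupp.single g (1 : K) ∈ strand K (F.deg j) (F.deg j g ⊔ G.deg k e) :=
    single_mem_strand le_sup_left _
  have he : Finsupp.single e (1 : K) ∈ strand K (G.deg k) (F.deg j g ⊔ G.deg k e) :=
    single_mem_strand le_sup_right _
  constructor
  · rw [starScalarMap_single]
    refine add_mem ?_ (Submodule.smul_mem _ _ ?_)
    · rcases j with _ | j
      · exact zero_mem _
      · exact starMul_mem_strand ((hF j).map_mem_strand hg) he
    · rcases k with _ | k
      · exact zero_mem _
      · exact starMul_mem_strand hg ((hG k).map_mem_strand he)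
  · rw [starScalarMap_single, map_add, map_smul]
    refine Eq.trans ?_ (congrArg₂ (fun x y => x + (-1 : K) ^ j • y)
      (homogenize_starScalarLeft F G j k g e hjk).symm
      (homogenize_starScalarRight F G j k g e hjk).symm)
    refine (Finsupp.linearCombination_single _ _ _).trans ?_
    rw [one_smul]
    dsimp only
    congr 1
    -- The sign is a polynomial in `star` but a scalar of `K` here; parity identifies the two
    -- actions.
    rcases Nat.even_or_odd j with h | h <;> simp [h.neg_one_pow]

/-- The homotopy `h ⊗ 1 + π ⊗ h'` on `F * G`. -/
noncomputable def starHomotopy (h : ∀ j, (F.B j →₀ K) →ₗ[K] (F.B (j + 1) →₀ K))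
    (π : ∀ j, (F.B j →₀ K) →ₗ[K] (F.B j →₀ K))
    (h' : ∀ k, (G.B k →₀ K) →ₗ[K] (G.B (k + 1) →₀ K)) (i : ℕ) :
    (StarBasis F G i →₀ K) →ₗ[K] (StarBasis F G (i + 1) →₀ K) :=
  Finsupp.linearCombination K fun b =>
    starMul (by have := b.add_eq; omega : b.j + 1 + b.k = i + 1)
        (h b.j (Finsupp.single b.left 1)) (Finsupp.single b.right 1) +
      starMul (by have := b.add_eq; omega : b.j + (b.k + 1) = i + 1)
        (π b.j (Finsupp.single b.left 1)) (h' b.k (Finsupp.single b.right 1))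

lemma starHomotopy_starMul (h : ∀ j, (F.B j →₀ K) →ₗ[K] (F.B (j + 1) →₀ K))
    (π : ∀ j, (F.B j →₀ K) →ₗ[K] (F.B j →₀ K))
    (h' : ∀ k, (G.B k →₀ K) →ₗ[K] (G.B (k + 1) →₀ K)) (hjk : j + k = i)
    (x : F.B j →₀ K) (y : G.B k →₀ K) :
    starHomotopy h π h' i (starMul hjk x y) =
      starMul (by omega : j + 1 + k = i + 1) (h j x) y +
        starMul (by omega : j + (k + 1) = i + 1) (π j x) (h' k y) := by
  suffices hs : (starMul hjk).compr₂ (starHomotopy h π h' i) =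
      (starMul (F := F) (G := G) (by omega : j + 1 + k = i + 1)).comp (h j) +
        (starMul (F := F) (G := G) (by omega : j + (k + 1) = i + 1)).compl₁₂ (π j) (h' k) from
    LinearMap.congr_fun₂ hs x y
  refine bilinear_ext fun g e => ?_
  simp only [LinearMap.compr₂_apply, LinearMap.compl₁₂_apply, LinearMap.comp_apply,
    LinearMap.add_apply]
  rw [starMul_single, one_mul]
  simp [starHomotopy]

end Product

/-! ### The Künneth argument by explicit homotopy -/

section Kuenneth

variable {F G} {a : Fin n → ℤ} {c : F.B 0 → K} {c' : G.B 0 → K} {Q Q' : Prop}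

/-- The projection onto the homology given by a contraction. -/
noncomputable def _root_.LcmTensor.Contraction.proj {C : ℕ → Type*} [∀ i, AddCommGroup (C i)]
    [∀ i, Module K (C i)] {V : ∀ i, Submodule K (C i)} {δ : ∀ i, C (i + 1) →ₗ[K] C i}
    {c : C 0 →ₗ[K] K} {Q : Prop} (s : Contraction V δ c Q) : ∀ j, C j →ₗ[K] C j
  | 0 => c.smulRight s.v
  | _ + 1 => 0

variable
  (s : Contraction (fun i => strand K (F.deg i) a) F.scalarMap (Finsupp.linearCombination K c) Q)
  (t : Contraction (fun i => strand K (G.deg i) a) G.scalarMap (Finsupp.linearCombination K c') Q')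

include s in
lemma proj_scalarMap (j : ℕ) {x : F.B (j + 1) →₀ K} (hx : x ∈ strand K (F.deg (j + 1)) a) :
    s.proj j (F.scalarMap j x) = 0 := by
  rcases j with _ | j
  · exact s.c_d_smul x hx
  · rfl

lemma starHomotopy_mem_strand (i : ℕ) {z : StarBasis F G i →₀ K}
    (hz : z ∈ strand K (StarBasis.deg (F := F) (G := G) (i := i)) a) :
    starHomotopy s.h s.proj t.h i z ∈ strand K (StarBasis.deg (F := F) (G := G) (i := i + 1)) a := by
  suffices h : strand K (StarBasis.deg (F := F) (G := G) (i := i)) a ≤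
      (strand K (StarBasis.deg (F := F) (G := G) (i := i + 1)) a).comap (starHomotopy s.h s.proj t.h i) from h hz
  refine strand_induction fun b hb => ?_
  obtain ⟨hg, he⟩ := sup_le_iff.1 hb
  have hx := single_mem_strand (deg := F.deg b.j) hg (1 : K)
  have hy := single_mem_strand (deg := G.deg b.k) he (1 : K)
  have hπ : ∀ j, ∀ x ∈ strand K (F.deg j) a, s.proj j x ∈ strand K (F.deg j) a := by
    rintro (_ | j) x -
    · exact Submodule.smul_mem _ _ s.v_mem
    · exact zero_mem _
  rw [Submodule.mem_comap]
  rw [single_eq_starMul b]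
  rw [starHomotopy_starMul]
  exact add_mem (starMul_mem_strand (s.h_mem _ _ hx) hy)
    (starMul_mem_strand (hπ _ _ hx) (t.h_mem _ _ hy))

/-- The terms `h x * d y` cancel by sign and `π` kills boundaries. What remains is `(1 - π) x * y +
π x * y`; as `π` lives in degree zero, `π ⊗ h'` needs no sign. -/
lemma starScalarMap_starHomotopy_succ (i : ℕ) {z : StarBasis F G (i + 1) →₀ K}
    (hz : z ∈ strand K (StarBasis.deg (F := F) (G := G) (i := i + 1)) a) :
    starScalarMap F G (i + 1) (starHomotopy s.h s.proj t.h (i + 1) z) +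
      starHomotopy s.h s.proj t.h i (starScalarMap F G i z) = z := by
  suffices h : strand K (StarBasis.deg (F := F) (G := G) (i := i + 1)) a ≤ LinearMap.eqLocus
      (starScalarMap F G (i + 1) ∘ₗ starHomotopy s.h s.proj t.h (i + 1) +
        starHomotopy s.h s.proj t.h i ∘ₗ starScalarMap F G i) LinearMap.id from h hz
  refine strand_induction fun b hb => ?_
  obtain ⟨hg, he⟩ := sup_le_iff.1 hb
  have hx := single_mem_strand (deg := F.deg b.j) hg (1 : K)
  have hy := single_mem_strand (deg := G.deg b.k) he (1 : K)
  rw [LinearMap.mem_eqLocus]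
  simp only [LinearMap.add_apply, LinearMap.comp_apply, LinearMap.id_apply]
  rw [single_eq_starMul b]
  clear hb hg he hz
  obtain ⟨j, k, g, e, hjk⟩ := b
  dsimp only at hx hy ⊢
  generalize Finsupp.single g (1 : K) = x at *
  generalize Finsupp.single e (1 : K) = y at *
  rw [starHomotopy_starMul]
  rcases j with _ | j <;> rcases k with _ | k
  · omega
  · rw [map_add, starScalarMap_starMul_succ_succ, starScalarMap_starMul_zero_succ,
      starScalarMap_starMul_zero_succ, starHomotopy_starMul, s.d_h_zero x hx]
    have : G.scalarMap (k + 1) (t.h (k + 1) y) = y - t.h k (G.scalarMap k y) :=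
      eq_sub_of_add_eq (t.d_h_succ k y hy)
    rw [this]
    simp only [Contraction.proj, LinearMap.smulRight_apply, map_sub, map_smul,
      LinearMap.sub_apply, LinearMap.smul_apply, zero_add, pow_one, neg_smul, one_smul]
    abel
  · rw [map_add, starScalarMap_starMul_succ_zero, starScalarMap_starMul_succ_zero,
      starHomotopy_starMul, proj_scalarMap s j hx]
    conv_rhs => rw [← s.d_h_succ j x hx]
    simp [Contraction.proj]
  · rw [map_add, starScalarMap_starMul_succ_succ, starScalarMap_starMul_succ_succ,
      starScalarMap_starMul_succ_succ, map_add, map_smul, starHomotopy_starMul, starHomotopy_starMul, proj_scalarMap s j hx]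
    conv_rhs => rw [← s.d_h_succ j x hx]
    simp only [Contraction.proj, map_add, map_zero, LinearMap.zero_apply, LinearMap.add_apply,
      add_zero, smul_zero]
    rw [pow_succ _ (j + 1)]
    simp only [mul_neg, mul_one, neg_smul]
    abel

variable (F G) in
/-- The scalars of the augmentation of `F * G`. -/
noncomputable def starAugment (c : F.B 0 → K) (c' : G.B 0 → K) (b : StarBasis F G 0) : K :=
  match b with
  | ⟨0, 0, g, e, _⟩ => c g * c' e
  | _ => 0

lemma linearCombination_starAugment (c : F.B 0 → K) (c' : G.B 0 → K) (x : F.B 0 →₀ K)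
    (y : G.B 0 →₀ K) :
    Finsupp.linearCombination K (starAugment F G c c') (starMul (add_zero 0) x y) =
      Finsupp.linearCombination K c x * Finsupp.linearCombination K c' y := by
  suffices hs : (starMul (add_zero 0)).compr₂
        (Finsupp.linearCombination K (starAugment F G c c')) =
      (LinearMap.mul K K).compl₁₂ (Finsupp.linearCombination K c)
        (Finsupp.linearCombination K c') from LinearMap.congr_fun₂ hs x y
  refine bilinear_ext fun g e => ?_
  simp only [LinearMap.compr₂_apply, LinearMap.compl₁₂_apply]
  rw [starMul_single]
  simp [starAugment]

/-- Here `(1 - π) ⊗ 1 + π ⊗ (1 - π') = 1 - π ⊗ π'`, so the homology is generated by `s.v * t.v`. -/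
lemma starScalarMap_starHomotopy_zero {z : StarBasis F G 0 →₀ K}
    (hz : z ∈ strand K (StarBasis.deg (F := F) (G := G) (i := 0)) a) :
    starScalarMap F G 0 (starHomotopy s.h s.proj t.h 0 z) =
      z - Finsupp.linearCombination K (starAugment F G c c') z •
        starMul (add_zero 0) s.v t.v := by
  suffices h : strand K (StarBasis.deg (F := F) (G := G) (i := 0)) a ≤ LinearMap.eqLocus
      (starScalarMap F G 0 ∘ₗ starHomotopy s.h s.proj t.h 0)
      (LinearMap.id - (Finsupp.linearCombination K (starAugment F G c c')).smulRight
        (starMul (add_zero 0) s.v t.v)) from h hz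
  refine strand_induction fun b hb => ?_
  obtain ⟨hg, he⟩ := sup_le_iff.1 hb
  have hx := single_mem_strand (deg := F.deg b.j) hg (1 : K)
  have hy := single_mem_strand (deg := G.deg b.k) he (1 : K)
  rw [LinearMap.mem_eqLocus]
  simp only [LinearMap.sub_apply, LinearMap.comp_apply, LinearMap.id_apply,
    LinearMap.smulRight_apply]
  rw [single_eq_starMul b]
  clear hb hg he hz
  obtain ⟨j, k, g, e, hjk⟩ := b
  obtain rfl : j = 0 := by omega
  obtain rfl : k = 0 := by omega
  dsimp only at hx hy ⊢
  generalize Finsupp.single g (1 : K) = x at *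
  generalize Finsupp.single e (1 : K) = y at *
  rw [starHomotopy_starMul, map_add, starScalarMap_starMul_succ_zero,
    starScalarMap_starMul_zero_succ, s.d_h_zero x hx, t.d_h_zero y hy,
    linearCombination_starAugment]
  simp [Contraction.proj, mul_smul, smul_sub]

end Kuenneth

variable {F G}

/-! ### `F * G` resolves the quotient by the sum -/

namespace StrandResolution

variable {A A' : Set (Fin n →₀ ℕ)} {c : F.B 0 → K} {c' : G.B 0 → K}
  (hF : F.StrandResolution A F.scalarMap c) (hG : G.StrandResolution A' G.scalarMap c')

include hF hG

lemma exact_star (a : Fin n → ℤ) (i : ℕ) (z : StarBasis F G (i + 1) →₀ K)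
    (hz : z ∈ strand K (StarBasis.deg (F := F) (G := G) (i := i + 1)) a)
    (h0 : starScalarMap F G i z = 0) :
    ∃ w ∈ strand K (StarBasis.deg (F := F) (G := G) (i := i + 2)) a,
      starScalarMap F G (i + 1) w = z := by
  obtain ⟨s⟩ := hF.nonempty_contraction a
  obtain ⟨t⟩ := hG.nonempty_contraction a
  refine ⟨_, starHomotopy_mem_strand s t (i + 1) hz, ?_⟩
  have := starScalarMap_starHomotopy_succ s t i hz
  rwa [h0, map_zero, add_zero] at this

/-- If neither factor vanishes in degree `a`, both functionals kill boundaries, hence so does their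
product. Conversely, the obstruction to being a boundary is a multiple of `s.v * t.v`, which is zero
once either quotient vanishes. -/
lemma exact_zero_star (a : Fin n → ℤ) (z : StarBasis F G 0 →₀ K)
    (hz : z ∈ strand K (StarBasis.deg (F := F) (G := G) (i := 0)) a) :
    (∃ w ∈ strand K (StarBasis.deg (F := F) (G := G) (i := 1)) a, starScalarMap F G 0 w = z) ↔
      Finsupp.linearCombination K (starAugment F G c c') z = 0 ∨ QuotVanishes (A ∪ A') a := by
  rw [quotVanishes_union]
  refine ⟨?_, fun h => ?_⟩
  · rintro ⟨w, hw, rfl⟩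
    by_contra! hne
    obtain ⟨hne, hA, hA'⟩ := hne
    refine hne ?_
    suffices h : strand K (StarBasis.deg (F := F) (G := G) (i := 1)) a ≤ LinearMap.ker
        (Finsupp.linearCombination K (starAugment F G c c') ∘ₗ starScalarMap F G 0) from h hw
    refine strand_induction fun b hb => ?_
    obtain ⟨hg, he⟩ := sup_le_iff.1 hb
    have hx := single_mem_strand (deg := F.deg b.j) hg (1 : K)
    have hy := single_mem_strand (deg := G.deg b.k) he (1 : K)
    rw [LinearMap.mem_ker, LinearMap.comp_apply]
    rw [single_eq_starMul b]
    clear hb hg he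
    obtain ⟨j, k, g, e, hjk⟩ := b
    dsimp only at hx hy ⊢
    generalize Finsupp.single g (1 : K) = x at *
    generalize Finsupp.single e (1 : K) = y at *
    obtain ⟨rfl, rfl⟩ | ⟨rfl, rfl⟩ : j = 1 ∧ k = 0 ∨ j = 0 ∧ k = 1 := by omega
    · rw [starScalarMap_starMul_succ_zero, linearCombination_starAugment,
        ((hF.exact_zero a _ ((hF.isHomogenization 0).map_mem_strand hx)).1
          ⟨x, hx, rfl⟩).resolve_right hA, zero_mul]
    · rw [starScalarMap_starMul_zero_succ, linearCombination_starAugment,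
        ((hG.exact_zero a _ ((hG.isHomogenization 0).map_mem_strand hy)).1
          ⟨y, hy, rfl⟩).resolve_right hA', mul_zero]
  · obtain ⟨s⟩ := hF.nonempty_contraction a
    obtain ⟨t⟩ := hG.nonempty_contraction a
    refine ⟨_, starHomotopy_mem_strand s t 0 hz, ?_⟩
    rw [starScalarMap_starHomotopy_zero s t hz, sub_eq_self]
    rcases h with h | h | h
    · rw [h, zero_smul]
    · rw [s.v_eq_zero h, map_zero, LinearMap.zero_apply, smul_zero]
    · rw [t.v_eq_zero h, map_zero, smul_zero]

lemma star : (F.star G).StrandResolution (A ∪ A') (starScalarMap F G)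
    (starAugment F G c c') := by
  refine ⟨isHomogenization_star hF.isHomogenization hG.isHomogenization,
    starScalarMap_starScalarMap hF.d_comp_d hG.d_comp_d, hF.exact_star hG,
    hF.exact_zero_star hG, ?_, ?_⟩
  · rintro ⟨j, k, g, e, hjk⟩ hb
    obtain rfl : j = 0 := by omega
    obtain rfl : k = 0 := by omega
    exact le_sup_of_le_left (hF.nonneg g (left_ne_zero_of_mul hb))
  · rw [quotVanishes_union]
    rcases hF.surj with h | ⟨g, hg, hg0⟩
    · exact Or.inl (Or.inl h)
    rcases hG.surj with h | ⟨e, he, he0⟩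
    · exact Or.inl (Or.inr h)
    refine Or.inr ⟨(⟨0, 0, g, e, rfl⟩ : StarBasis F G 0), mul_ne_zero hg he, ?_⟩
    change F.deg 0 g ⊔ G.deg 0 e = 0
    rw [hg0, he0, sup_idem]

end StrandResolution

lemma IsFinite.star (hF : F.IsFinite) (hG : G.IsFinite) : (F.star G).IsFinite := by
  obtain ⟨hF, p, hp⟩ := hF
  obtain ⟨hG, q, hq⟩ := hG
  refine ⟨fun i => ?_, p + q, fun i hi => ⟨?_⟩⟩
  · let f : StarBasis F G i → Σ j : Fin (i + 1), Σ k : Fin (i + 1), F.B j × G.B k := fun b =>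
      ⟨⟨b.j, by have := b.add_eq; omega⟩, ⟨b.k, by have := b.add_eq; omega⟩, b.left, b.right⟩
    refine Finite.of_injective f ?_
    rintro ⟨j, k, g, e, h⟩ ⟨j', k', g', e', h'⟩ hb
    simp only [f, Sigma.mk.injEq, Fin.mk.injEq] at hb
    obtain ⟨rfl, hb⟩ := hb
    simp only [heq_eq_eq, Sigma.mk.injEq, Fin.mk.injEq] at hb
    obtain ⟨rfl, hb⟩ := hb
    simp only [heq_eq_eq, Prod.mk.injEq] at hb
    obtain ⟨rfl, rfl⟩ := hb
    rfl
  · rintro ⟨j, k, g, e, h⟩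
    rcases (by omega : p < j ∨ q < k) with h | h
    · exact (hp j h).false g
    · exact (hq k h).false e

end FreeSequence

end LcmTensor

theorem theorem2p1 {K : Type*} [Field K] {n : ℕ}
    (I J : Ideal (MvPolynomial (Fin n) K))
    (hI : LcmTensor.IsMonomialIdeal I) (hJ : LcmTensor.IsMonomialIdeal J)
    (F G : LcmTensor.FreeSequence K n)
    (hF : F.IsMultigradedFreeResolution I) (hG : G.IsMultigradedFreeResolution J) :
    (F.star G).IsMultigradedFreeResolution (I + J) ∧
      (F.IsFinite → G.IsFinite → (F.star G).IsFinite) := by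
  obtain ⟨A, rfl⟩ := hI
  obtain ⟨A', rfl⟩ := hJ
  obtain ⟨c, hc⟩ := hF.exists_strandResolution
  obtain ⟨c', hc'⟩ := hG.exists_strandResolution
  refine ⟨?_, LcmTensor.FreeSequence.IsFinite.star⟩
  -- The sum of the ideals is generated by the union of the two sets of monomials.
  rw [Submodule.add_eq_sup, ← Ideal.span_union, ← Set.image_union]
  exact (hc.star hc').isMultigradedFreeResolution
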